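/- A hypergraph on a finite vertex set $V$ has as its edges a multiset of subsets of $V$, each with at least two elements (multiple edges are allowed). A walk is a sequence $v_0,e_1,v_1,\dots,e_m,v_m$ of vertices $v_i$ and edges $e_i$ with $\{v_{i-1},v_i\}\subseteq e_i$ for all $i$. It is a path if all its vertices are distinct and all its edges are distinct. It is a cycle if $m\ge 2$, all its edges are distinct, and all its vertices are distinct except that $v_0=v_m$. A hypertree is a hypergraph that has no cycles and in which any two vertices are joined by a path. For $n\ge 1$ and a finitely supported sequence $\lambda=(\lambda_2,\lambda_3,\dots)$ of nonnegative integers, let $\tau_{n,\lambda}$ be the number of labeled hypertrees with $n$ vertices, labeled by $1,\dots,n$, and with exactly $\lambda_j$ edges of size $j$, labeled by $1,\dots,\lambda_j$, for each $j\ge 2$. Let $t,u_2,u_3,\dots$ be indeterminates and let $$T=\sum_{n\ge 1}\frac{t^n}{n!}\sum_{\lambda}\tau_{n,\lambda}\prod_{j\ge 2}\frac{u_j^{\lambda_j}}{\lambda_j!}$$ be the exponential generating function of hypertrees, a formal power series over $\mathbb{Q}$. Put $R=t\,\dfrac{\partial T}{\partial t}$. Then the series $\sum_{j\ge 2}(j-1)\,u_j\,\dfrac{R^j}{j!}$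 converges in the ring of formal power series (with coefficientwise convergence, $\mathbb{Q}$ being discrete), and $$T=R-\sum_{j=2}^{\infty}(j-1)\,u_j\,\frac{R^j}{j!}.$$ -/

import Mathlib

open scoped Nat MvPowerSeries.WithPiTopology

/-- A hypergraph with vertex set `V` and edges named by `E`: each edge is a set of at least two
vertices, and differently named edges may have the same set of vertices (multiple edges). -/
@[ext]
structure MultiHypergraph (V E : Type*) where
  /-- the set of vertices of an edge -/
  ends : E → Finset V
  two_le_card : ∀ e, 2 ≤ (ends e).card

namespace MultiHypergraph

/-- `v 0, e 0, v 1, …, e (m - 1), v m` is a walk: each edge contains the vertices next to it. -/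
def IsWalk {V E : Type*} (H : MultiHypergraph V E) {m : ℕ}
    (v : Fin (m + 1) → V) (e : Fin m → E) : Prop :=
  ∀ i : Fin m, v i.castSucc ∈ H.ends (e i) ∧ v i.succ ∈ H.ends (e i)

/-- A path is a walk with distinct vertices and distinct edges. -/
def IsPath {V E : Type*} (H : MultiHypergraph V E) {m : ℕ}
    (v : Fin (m + 1) → V) (e : Fin m → E) : Prop :=
  H.IsWalk v e ∧ Function.Injective v ∧ Function.Injective e

/-- A cycle is a walk with at least two edges, in which all edges are distinct, and all vertices
are distinct except that the last one is the first one. -/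
def IsCycle {V E : Type*} (H : MultiHypergraph V E) {m : ℕ}
    (v : Fin (m + 1) → V) (e : Fin m → E) : Prop :=
  H.IsWalk v e ∧ 2 ≤ m ∧ Function.Injective e ∧
    Function.Injective (fun i : Fin m => v i.castSucc) ∧ v (Fin.last m) = v 0

/-- Any two vertices are joined by a path. -/
def IsConnected {V E : Type*} (H : MultiHypergraph V E) : Prop :=
  ∀ a b : V, ∃ (m : ℕ) (v : Fin (m + 1) → V) (e : Fin m → E),
    H.IsPath v e ∧ v 0 = a ∧ v (Fin.last m) = b

/-- A hypertree is a connected hypergraph without cycles. -/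
def IsHypertree {V E : Type*} (H : MultiHypergraph V E) : Prop :=
  H.IsConnected ∧
    ¬ ∃ (m : ℕ) (v : Fin (m + 1) → V) (e : Fin m → E), H.IsCycle v e

instance {V E : Type*} [Finite V] [Finite E] : Finite (MultiHypergraph V E) :=
  Finite.of_injective (fun H : MultiHypergraph V E => H.ends) fun _ _ h => MultiHypergraph.ext h

end MultiHypergraph

/-- The possible sizes `j ≥ 2` of an edge. -/
abbrev EdgeSize : Type := {j : ℕ // 2 ≤ j}

/-- The edge labels of a labeled hypergraph with `lam j` edges of size `j` for each `j`:
the label `⟨j, k⟩` is that of the `k`-th `j`-edge. -/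
abbrev EdgeLabel (lam : EdgeSize →₀ ℕ) : Type := Σ j : EdgeSize, Fin (lam j)

/-- There are only finitely many edge labels, so that the counts below are counts of finite
sets. -/
instance (lam : EdgeSize →₀ ℕ) : Finite (EdgeLabel lam) := by
  refine Finite.of_injective (β := Σ j : lam.support, Fin (lam j))
    (fun e => ⟨⟨e.1, Finsupp.mem_support_iff.2 fun h => (Fin.cast h e.2).elim0⟩, e.2⟩) ?_
  rintro ⟨j, k⟩ ⟨j', k'⟩ h
  simp only [Sigma.mk.injEq, Subtype.mk.injEq] at h
  obtain ⟨rfl, h⟩ := h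
  simpa using h

/-- The number of labeled hypertrees with `n` labeled vertices and, for each `j`,
exactly `lam j` edges of size `j`, labeled by `Fin (lam j)`. -/
noncomputable def hypertreeCount (n : ℕ) (lam : EdgeSize →₀ ℕ) : ℕ :=
  Nat.card {H : MultiHypergraph (Fin n) (EdgeLabel lam) //
    (∀ e : EdgeLabel lam, (H.ends e).card = e.1) ∧ H.IsHypertree}

/-- Formal power series over `ℚ` in the indeterminates `t` and `u j` for `j ≥ 2`;
`none` is the index of `t`, and `some j` that of `u j`. -/
abbrev HypergraphSeries : Type := MvPowerSeries (Option EdgeSize) ℚ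

namespace HypergraphSeries

/-- The indeterminate `t` marking vertices. -/
noncomputable def t : HypergraphSeries := MvPowerSeries.X none

/-- The indeterminate `u j` marking edges of size `j`. -/
noncomputable def u (j : EdgeSize) : HypergraphSeries := MvPowerSeries.X (some j)

/-- The partial derivative with respect to `t`. -/
noncomputable def dt (F : HypergraphSeries) : HypergraphSeries := MvPowerSeries.pderiv ℚ none F

/-- The exponential generating function `T` of hypertrees: for `n ≥ 1`, the coefficient of
`(t ^ n / n!) * ∏ j, (u j) ^ lam j / (lam j)!` is the number of labeled hypertrees with `n`
vertices and `lam j` edges of size `j` for all `j`. The monomials without `t` do not occur. -/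
noncomputable def hypertreeEGF : HypergraphSeries := fun d =>
  if d none = 0 then 0
  else (hypertreeCount (d none) d.some : ℚ) / ((d none)! * d.some.prod fun _ k => (k ! : ℚ))

end HypergraphSeries

/-! The proof rests on two facts. First, deleting an edge of size `j` from a hypertree leaves `j`
hypertrees, each rooted at its vertex on that edge, and gluing along a new edge reverses this. Since
`R` counts rooted hypertrees, `R ^ j = j! * ∂T/∂u_j` (`rooted_pow`), so `u_j * R ^ j / j!` counts
hypertrees weighted by their number of `j`-edges. Second, the bipartite incidence graph of a
hypertree is a tree, so `n - ∑ (j - 1) * λ_j = 1` (`coeff_hypertreeEGF_eq`). Weighting every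
hypertree by this 1 gives the identity; at each monomial only finitely many `j` contribute.

The combinatorial core is `sum_prod_card_rooted`. It is read as an identity of series through
`egfCoeff_prod`, and `incGraph_isTree_iff` replaces paths and cycles by graph-theoretic trees. -/

/-- A derivation applied to a finite product. -/
theorem Derivation.leibniz_prod_update {R A ι : Type*} [CommRing R] [CommRing A] [Algebra R A]
    [DecidableEq ι] (D : Derivation R A A) (s : Finset ι) (f : ι → A) :
    D (∏ i ∈ s, f i) = ∑ i ∈ s, ∏ k ∈ s, Function.update f i (D (f i)) k := by
  induction s using Finset.induction_on with
  | empty => simp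
  | insert a s ha ih =>
    rw [Finset.prod_insert ha, Derivation.leibniz, ih, Finset.sum_insert ha,
      Finset.prod_insert ha, Function.update_self, add_comm, smul_eq_mul, smul_eq_mul,
      Finset.mul_sum, mul_comm]
    congr 1
    · congr 1
      refine Finset.prod_congr rfl fun k hk => ?_
      rw [Function.update_of_ne (by rintro rfl; exact ha hk)]
    · refine Finset.sum_congr rfl fun i hi => ?_
      rw [Finset.prod_insert ha, Function.update_of_ne (by rintro rfl; exact ha hi)]

/-! ### Exponential coefficients and the product formula -/

namespace MvPowerSeries

variable {σ : Type*}

/-- The coefficient of a power series with respect to the divided powers `∏ i, X i ^ d i / (d i)!`. -/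
noncomputable def egfCoeff (d : σ →₀ ℕ) (F : MvPowerSeries σ ℚ) : ℚ :=
  (d.prod fun _ k => (k ! : ℚ)) * coeff d F

theorem prod_factorial_ne_zero (d : σ →₀ ℕ) : (d.prod fun _ k => (k ! : ℚ)) ≠ 0 :=
  Finset.prod_ne_zero_iff.2 fun _ _ => by positivity

theorem prod_factorial_add_single (d : σ →₀ ℕ) (i : σ) :
    ((d + Finsupp.single i 1).prod fun _ k => (k ! : ℚ)) =
      (d i + 1) * d.prod fun _ k => (k ! : ℚ) := by
  classical
  -- Both products are taken over `insert i d.support`, because the supports differ when `d i = 0`.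
  have h (e : σ →₀ ℕ) (he : e.support ⊆ insert i d.support) :
      (e.prod fun _ k => (k ! : ℚ)) =
        (e i)! * ∏ x ∈ (insert i d.support).erase i, ((e x)! : ℚ) := by
    rw [Finset.mul_prod_erase _ (fun x => ((e x)! : ℚ)) (Finset.mem_insert_self _ _)]
    exact Finsupp.prod_of_support_subset _ he _ (by simp)
  rw [h d (Finset.subset_insert _ _), h (d + Finsupp.single i 1)]
  · rw [← mul_assoc]
    congr 1
    · simp [Nat.factorial_succ]
    · refine Finset.prod_congr rfl fun x hx => ?_
      simp [Finsupp.single_eq_of_ne (Finset.ne_of_mem_erase hx)]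
  · intro x hx
    by_cases hxi : x = i
    · simp [hxi]
    · have : d x ≠ 0 := by simpa [Finsupp.single_eq_of_ne hxi] using hx
      simp [this]

/-- In divided powers a partial derivative is a mere shift. Combinatorially, differentiating sets
aside one label of colour `i`. -/
theorem egfCoeff_add_single (d : σ →₀ ℕ) (i : σ) (F : MvPowerSeries σ ℚ) :
    egfCoeff (d + Finsupp.single i 1) F = egfCoeff d (pderiv ℚ i F) := by
  rw [egfCoeff, egfCoeff, prod_factorial_add_single, coeff_pderiv]
  ring

theorem egfCoeff_sum {ι : Type*} (d : σ →₀ ℕ) (s : Finset ι) (F : ι → MvPowerSeries σ ℚ) :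
    egfCoeff d (∑ i ∈ s, F i) = ∑ i ∈ s, egfCoeff d (F i) := by
  simp only [egfCoeff, map_sum, Finset.mul_sum]

/-- The product formula for exponential generating functions: the coefficient of a product is
the sum over the distributions of a finite set of coloured labels. -/
theorem egfCoeff_prod {ι L : Type*} [Fintype ι] [DecidableEq ι] [Fintype L] [DecidableEq L]
    (col : L → σ) (F : ι → MvPowerSeries σ ℚ) :
    egfCoeff (∑ l, Finsupp.single (col l) 1) (∏ i, F i) =
      ∑ c : L → ι, ∏ i, egfCoeff (∑ l, if c l = i then Finsupp.single (col l) 1 else 0) (F i) := by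
  refine Finite.induction_empty_option (P := fun L => ∀ [Fintype L] [DecidableEq L], ∀ (col : L → σ)
      (F : ι → MvPowerSeries σ ℚ),
      egfCoeff (∑ l, Finsupp.single (col l) 1) (∏ i, F i) =
      ∑ c : L → ι, ∏ i, egfCoeff (∑ l, if c l = i then Finsupp.single (col l) 1 else 0) (F i))
    ?_ ?_ ?_ L col F
  · intro α β e h _ _ col F
    let _ : Fintype α := Fintype.ofEquiv β e.symm
    let _ : DecidableEq α := e.decidableEq
    have := h (col ∘ e) F
    rw [← Fintype.sum_equiv (e.arrowCongr (Equiv.refl ι)) _ _ (fun _ => rfl)]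
    rw [← Fintype.sum_equiv e (fun l => Finsupp.single (col (e l)) 1) _ (fun _ => rfl)]
    refine this.trans (Finset.sum_congr rfl fun c _ => Finset.prod_congr rfl fun i _ => ?_)
    congr 1
    exact Fintype.sum_equiv e _ _ fun l => by simp
  · intro _ _ col F
    simp [egfCoeff, coeff_zero_eq_constantCoeff, map_prod]
  · intro α _ ih hα hd col F
    let _ : DecidableEq α := Classical.decEq α
    obtain rfl : hα = instFintypeOption := Subsingleton.elim _ _
    obtain rfl : hd = Option.instDecidableEq := Subsingleton.elim _ _
    -- Setting aside the label `none` differentiates the product; the Leibniz term at `i₀` collects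
    -- the distributions that give `none` to `i₀`.
    rw [Fintype.sum_option, add_comm, egfCoeff_add_single, Derivation.leibniz_prod_update,
      egfCoeff_sum]
    simp_rw [ih]
    rw [← Fintype.sum_equiv (Equiv.piOptionEquivProd (β := fun _ => ι)).symm _ _ (fun _ => rfl),
      Fintype.sum_prod_type]
    refine Finset.sum_congr rfl fun i₀ _ => Finset.sum_congr rfl fun c _ =>
      Finset.prod_congr rfl fun i _ => ?_
    rw [Fintype.sum_option]
    by_cases hi : i = i₀
    · subst hi
      simp [Equiv.piOptionEquivProd, add_comm (Finsupp.single (col none) 1),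
        egfCoeff_add_single]
      rfl
    · simp [Equiv.piOptionEquivProd, hi, Ne.symm hi]
      rfl

end MvPowerSeries

/-! ### Hypertrees as trees: the incidence graph -/

namespace MultiHypergraph

variable {V E : Type*} (H : MultiHypergraph V E)

/-- The incidence relation between vertices and edges, as a relation on their disjoint union. -/
def IncAdj : V ⊕ E → V ⊕ E → Prop
  | .inl v, .inr e => v ∈ H.ends e
  | .inr e, .inl v => v ∈ H.ends e
  | _, _ => False

/-- The bipartite incidence graph of a hypergraph. -/
def incGraph : SimpleGraph (V ⊕ E) where
  Adj := H.IncAdj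
  symm := ⟨by rintro (v | e) (w | f) h <;> exact h⟩
  loopless := ⟨by rintro (v | e) h <;> exact h⟩

variable {H}

@[simp] theorem incGraph_adj_inl_inr {v : V} {e : E} :
    H.incGraph.Adj (.inl v) (.inr e) ↔ v ∈ H.ends e := Iff.rfl

@[simp] theorem incGraph_adj_inr_inl {v : V} {e : E} :
    H.incGraph.Adj (.inr e) (.inl v) ↔ v ∈ H.ends e := Iff.rfl

@[simp] theorem not_incGraph_adj_inl_inl {v w : V} : ¬ H.incGraph.Adj (.inl v) (.inl w) := id

@[simp] theorem not_incGraph_adj_inr_inr {e f : E} : ¬ H.incGraph.Adj (.inr e) (.inr f) := id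

theorem exists_mem_ends (H : MultiHypergraph V E) (e : E) : ∃ v, v ∈ H.ends e :=
  Finset.card_pos.1 (by have := H.two_le_card e; omega)

theorem IsWalk.reachable {m : ℕ} {v : Fin (m + 1) → V} {e : Fin m → E} (h : H.IsWalk v e)
    (i : Fin (m + 1)) : H.incGraph.Reachable (.inl (v 0)) (.inl (v i)) := by
  induction i using Fin.induction with
  | zero => exact .refl _
  | succ i ih =>
    refine ih.trans (.trans (v := .inr (e i)) (SimpleGraph.Adj.reachable ?_)
      (SimpleGraph.Adj.reachable ?_))
    · exact (h i).1
    · exact (h i).2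

theorem IsConnected.incGraph_connected [Nonempty V] (h : H.IsConnected) :
    H.incGraph.Connected := by
  have hV (a b : V) : H.incGraph.Reachable (.inl a) (.inl b) := by
    obtain ⟨m, v, e, hp, rfl, rfl⟩ := h a b
    exact hp.1.reachable _
  obtain ⟨a⟩ := ‹Nonempty V›
  refine SimpleGraph.connected_iff_exists_forall_reachable _ |>.2 ⟨.inl a, ?_⟩
  rintro (b | e)
  · exact hV a b
  · obtain ⟨b, hb⟩ := H.exists_mem_ends e
    exact (hV a b).trans (SimpleGraph.Adj.reachable (G := H.incGraph) hb)

/-- The rest of the cycle leads from `e 0` back to `v 0` without the incidence of `v 0` and `e 0`,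
which is therefore not a bridge. -/
theorem IsCycle.not_isAcyclic {m : ℕ} {v : Fin (m + 1) → V} {e : Fin m → E}
    (h : H.IsCycle v e) : ¬ H.incGraph.IsAcyclic := by
  obtain ⟨hw, hm, he, hv, hl⟩ := h
  -- With at least two edges, `v 1` is among the vertices known to be distinct from `v 0`.
  obtain ⟨m, rfl⟩ : ∃ k, m = k + 2 := ⟨m - 2, by omega⟩
  rw [SimpleGraph.isAcyclic_iff_forall_adj_isBridge]
  intro hb
  have hb := hb (v := .inl (v 0)) (w := .inr (e 0)) (hw 0).1
  rw [SimpleGraph.isBridge_iff] at hb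
  refine hb (SimpleGraph.Reachable.symm ?_)
  set G := H.incGraph.deleteEdges {s(.inl (v 0), .inr (e 0))} with hG
  have hadj {a : V} {f : E} (h1 : a ∈ H.ends f) (h2 : a ≠ v 0 ∨ f ≠ e 0) :
      G.Adj (.inl a) (.inr f) := by
    rw [hG, SimpleGraph.deleteEdges_adj]
    refine ⟨h1, ?_⟩
    simp only [Set.mem_singleton_iff, Sym2.eq_iff, Sum.inl.injEq, Sum.inr.injEq, reduceCtorEq,
      and_self, or_false]
    tauto
  have key (i : Fin (m + 2)) : G.Reachable (.inr (e 0)) (.inl (v i.succ)) := by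
    induction i using Fin.induction with
    | zero =>
      refine (hadj (hw 0).2 (.inl fun h => ?_)).symm.reachable
      have := @hv 1 0 (by simpa using h)
      simp at this
    | succ i ih =>
      have hne : e i.succ ≠ e 0 := fun h => Fin.succ_ne_zero i (he h)
      exact ih.trans ((hadj (hw i.succ).1 (.inr hne)).reachable.trans
        (hadj (hw i.succ).2 (.inr hne)).symm.reachable)
  have := key (Fin.last _)
  rwa [Fin.succ_last, hl] at this

section walk

open SimpleGraph

theorem isLeft_getVert_iff {x y : V ⊕ E} (hx : x.isLeft) (p : H.incGraph.Walk x y) {i : ℕ}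
    (hi : i ≤ p.length) : (p.getVert i).isLeft ↔ Even i := by
  induction i with
  | zero => simpa using hx
  | succ i ih =>
    have h1 := p.adj_getVert_succ (i := i) (by omega)
    have h2 := ih (by omega)
    rw [Nat.even_add_one, ← h2]
    revert h1
    cases p.getVert i <;> cases p.getVert (i + 1) <;> simp

/-- A walk between two vertices in the incidence graph is a walk in the hypergraph. -/
theorem exists_isWalk_of_walk {a b : V} (p : H.incGraph.Walk (.inl a) (.inl b)) :
    ∃ (m : ℕ) (v : Fin (m + 1) → V) (e : Fin m → E), p.length = 2 * m ∧ H.IsWalk v e ∧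
      (∀ i : Fin (m + 1), p.getVert (2 * i) = .inl (v i)) ∧
      (∀ i : Fin m, p.getVert (2 * i + 1) = .inr (e i)) := by
  obtain ⟨m, hm⟩ : Even p.length := by
    rw [← isLeft_getVert_iff rfl p le_rfl, p.getVert_length]; rfl
  have hv (i : Fin (m + 1)) : ∃ v, p.getVert (2 * i) = .inl v := by
    have := (isLeft_getVert_iff rfl p (i := 2 * i) (by omega)).2 (by simp)
    exact Sum.isLeft_iff.1 this
  have he (i : Fin m) : ∃ e, p.getVert (2 * i + 1) = .inr e := by
    have := (isLeft_getVert_iff rfl p (i := 2 * i + 1) (by omega)).not.2 (by simp)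
    exact Sum.isRight_iff.1 (by simpa using this)
  choose v hv using hv
  choose e he using he
  refine ⟨m, v, e, by omega, fun i => ⟨?_, ?_⟩, hv, he⟩
  · have := p.adj_getVert_succ (i := 2 * i) (by omega)
    rwa [he i, show 2 * (i : ℕ) = 2 * (i.castSucc : ℕ) from rfl, hv] at this
  · have := p.adj_getVert_succ (i := 2 * i + 1) (by omega)
    rwa [he i, show 2 * (i : ℕ) + 1 + 1 = 2 * (i.succ : ℕ) by simp; ring, hv] at this

theorem isConnected_of_incGraph (h : H.incGraph.Connected) : H.IsConnected := by
  intro a b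
  obtain ⟨p, hp⟩ := h.exists_isPath (.inl a) (.inl b)
  obtain ⟨m, v, e, hm, hw, hv, he⟩ := exists_isWalk_of_walk p
  have hinj := hp.getVert_injOn
  refine ⟨m, v, e, ⟨hw, fun i j hij => ?_, fun i j hij => ?_⟩, ?_, ?_⟩
  · have := hinj (x₁ := 2 * i) (x₂ := 2 * j) (by simp; omega) (by simp; omega)
      (by rw [hv, hv, hij])
    omega
  · have := hinj (x₁ := 2 * i + 1) (x₂ := 2 * j + 1) (by simp; omega) (by simp; omega)
      (by rw [he, he, hij])
    omega
  · have := hv 0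
    simpa using this.symm
  · have := hv (Fin.last m)
    rw [Fin.val_last, ← hm, p.getVert_length] at this
    simpa using this.symm

theorem incGraph_isAcyclic
    (h : ¬ ∃ (m : ℕ) (v : Fin (m + 1) → V) (e : Fin m → E), H.IsCycle v e) :
    H.incGraph.IsAcyclic := by
  classical
  have main (a : V) (p : H.incGraph.Walk (.inl a) (.inl a)) : ¬ p.IsCycle := by
    intro hp
    obtain ⟨m, v, e, hm, hw, hv, he⟩ := exists_isWalk_of_walk p
    have hinj := hp.getVert_injOn'
    have h3 := hp.three_le_length
    refine h ⟨m, v, e, hw, by omega, fun i j hij => ?_, fun i j hij => ?_, ?_⟩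
    · have := hinj (x₁ := 2 * i + 1) (x₂ := 2 * j + 1) (by simp; omega) (by simp; omega)
        (by rw [he, he, hij])
      omega
    · have := hinj (x₁ := 2 * i.castSucc) (x₂ := 2 * j.castSucc) (by simp; omega) (by simp; omega)
        (by rw [hv, hv]; exact congrArg Sum.inl hij)
      simp at this
      omega
    · have h0 := hv 0
      have h1 := hv (Fin.last m)
      rw [Fin.val_last, ← hm, p.getVert_length] at h1
      simp at h0 h1
      rw [← h0, ← h1]
  -- A cycle based at a hyperedge is rotated to start at the next vertex.
  rintro (a | f) p hp
  · exact main a p hp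
  · have hadj := p.adj_getVert_succ (i := 0) (by have := hp.three_le_length; omega)
    have hmem := p.getVert_mem_support (0 + 1)
    revert hadj hmem
    rw [p.getVert_zero]
    rcases p.getVert (0 + 1) with a | g
    · intro _ hmem
      exact main a _ (hp.rotate hmem)
    · simp

end walk

/-- Nonemptiness must be added: with no vertices the hypertree conditions hold vacuously, whereas a
tree has a node. -/
theorem incGraph_isTree_iff : H.incGraph.IsTree ↔ Nonempty V ∧ H.IsHypertree := by
  constructor
  · intro h
    refine ⟨?_, isConnected_of_incGraph h.connected, ?_⟩
    · obtain ⟨v | e⟩ := h.connected.nonempty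
      · exact ⟨v⟩
      · exact ⟨(H.exists_mem_ends e).choose⟩
    · rintro ⟨m, v, e, hc⟩
      exact hc.not_isAcyclic h.isAcyclic
  · rintro ⟨_, h⟩
    exact ⟨h.1.incGraph_connected, incGraph_isAcyclic h.2⟩

theorem card_incGraph_edgeSet [Fintype E] :
    Nat.card H.incGraph.edgeSet = ∑ e, (H.ends e).card := by
  let f : (Σ e, H.ends e) → H.incGraph.edgeSet :=
    fun x => ⟨s(.inl x.2.1, .inr x.1), x.2.2⟩
  have hf : Function.Bijective f := by
    constructor
    · rintro ⟨e, v, hv⟩ ⟨e', v', hv'⟩ h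
      have h : s(Sum.inl v, Sum.inr e) = s(Sum.inl v', Sum.inr e') := congrArg Subtype.val h
      simp only [Sym2.eq_iff, Sum.inl.injEq, Sum.inr.injEq, reduceCtorEq, and_self,
        or_false] at h
      obtain ⟨rfl, rfl⟩ := h
      rfl
    · rintro ⟨x, hx⟩
      induction x using Sym2.ind with
      | _ x y =>
        rcases x with v | e <;> rcases y with w | g
        · exact hx.elim
        · exact ⟨⟨g, v, hx⟩, rfl⟩
        · exact ⟨⟨e, w, hx⟩, Subtype.ext Sym2.eq_swap⟩
        · exact hx.elim
  rw [← Nat.card_eq_of_bijective f hf, Nat.card_sigma]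
  simp

/-- Used in both directions: to get acyclicity of a glued hypergraph by counting, and to relate the
vertex and edge numbers of a hypertree. -/
theorem incGraph_isTree_iff_card [Fintype V] [Fintype E] :
    H.incGraph.IsTree ↔ H.incGraph.Connected ∧
      ∑ e, (H.ends e).card + 1 = Fintype.card V + Fintype.card E := by
  rw [SimpleGraph.isTree_iff_connected_and_card, card_incGraph_edgeSet, Nat.card_eq_fintype_card,
    Fintype.card_sum]

end MultiHypergraph

/-! ### Deleting an edge and gluing rooted parts -/

namespace MultiHypergraph

variable {V E ι : Type*}

/-- The hypergraph obtained by removing the edge `none`. -/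
def removeNone (H : MultiHypergraph V (Option E)) : MultiHypergraph V E where
  ends e := H.ends (some e)
  two_le_card e := H.two_le_card (some e)

/-- `c` splits what remains of `H` without the edge `none` into one part for each of the
vertices `r i` of that edge. -/
structure IsSplitting (H : MultiHypergraph V (Option E)) (r : ι → V) (c : V ⊕ E → ι) : Prop where
  mem_ends_none : ∀ v, v ∈ H.ends none ↔ ∃ i, r i = v
  root : ∀ i, c (.inl (r i)) = i
  adj : ∀ v e, v ∈ H.ends (some e) → c (.inl v) = c (.inr e)

/-- Follow a walk in `H` from the deleted edge: each time it leaves that edge it arrives at some `r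
i`, and from there on it uses only remaining incidences. -/
theorem reachable_removeNone {H : MultiHypergraph V (Option E)} (hH : H.incGraph.Connected)
    {r : ι → V} (hr : ∀ v, v ∈ H.ends none ↔ ∃ i, r i = v) (x : V ⊕ E) :
    ∃ i, H.removeNone.incGraph.Reachable (.inl (r i)) x := by
  have key (y : V ⊕ Option E) : ∀ x : V ⊕ E, y = Sum.map id some x →
      ∃ i, H.removeNone.incGraph.Reachable (.inl (r i)) x := by
    have hy := hH.preconnected (.inr none) y
    rw [SimpleGraph.reachable_iff_reflTransGen] at hy
    induction hy with
    | refl => rintro (v | e) h <;> simp at h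
    | @tail y z _ hyz ih =>
      rintro x rfl
      rcases y with w | _ | f <;> rcases x with v | e
      · exact hyz.elim
      · obtain ⟨i, hi⟩ := ih (.inl w) rfl
        exact ⟨i, hi.trans (SimpleGraph.Adj.reachable (G := H.removeNone.incGraph) hyz)⟩
      · obtain ⟨i, rfl⟩ := (hr v).1 hyz
        exact ⟨i, .refl _⟩
      · exact hyz.elim
      · obtain ⟨i, hi⟩ := ih (.inr f) rfl
        exact ⟨i, hi.trans (SimpleGraph.Adj.reachable (G := H.removeNone.incGraph) hyz)⟩
      · exact hyz.elim
  exact key _ x rfl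

/-- Otherwise the connection followed by the incidence of `r k` with `none` bypasses the incidence
of `r i` with `none`, which is a bridge. -/
theorem eq_of_reachable_removeNone {H : MultiHypergraph V (Option E)} (hH : H.incGraph.IsAcyclic)
    {r : ι → V} (hr : ∀ v, v ∈ H.ends none ↔ ∃ i, r i = v) (hinj : Function.Injective r) {i k : ι}
    (h : H.removeNone.incGraph.Reachable (.inl (r i)) (.inl (r k))) : i = k := by
  by_contra hik
  rw [SimpleGraph.isAcyclic_iff_forall_adj_isBridge] at hH
  have hb := hH (v := .inl (r i)) (w := .inr none) ((hr _).2 ⟨i, rfl⟩)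
  rw [SimpleGraph.isBridge_iff] at hb
  let f : H.removeNone.incGraph →g H.incGraph.deleteEdges {s(.inl (r i), .inr none)} :=
    { toFun := Sum.map id some
      map_rel' := by
        rintro (v | e) (w | g) h
        · exact h.elim
        · exact SimpleGraph.deleteEdges_adj.2 ⟨h, by simp⟩
        · exact SimpleGraph.deleteEdges_adj.2 ⟨h, by simp⟩
        · exact h.elim }
  refine hb ((h.map f).trans (SimpleGraph.Adj.reachable ?_))
  refine SimpleGraph.deleteEdges_adj.2 ⟨(hr _).2 ⟨k, rfl⟩, ?_⟩
  have : ¬ r k = r i := fun h => hik (hinj h).symm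
  simp [f, this]

theorem IsSplitting.eq_of_reachable {H : MultiHypergraph V (Option E)} {r : ι → V}
    {c : V ⊕ E → ι} (hc : H.IsSplitting r c) {x y : V ⊕ E}
    (h : H.removeNone.incGraph.Reachable x y) : c x = c y := by
  rw [SimpleGraph.reachable_iff_reflTransGen] at h
  induction h with
  | refl => rfl
  | @tail y z _ hyz ih =>
    rw [ih]
    rcases y with v | e <;> rcases z with w | g
    · exact hyz.elim
    · exact hc.adj _ _ hyz
    · exact (hc.adj _ _ hyz).symm
    · exact hyz.elim

/-- The colour of a node names the root in its component. Uniqueness makes a sum over colourings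
count each hypertree with numbered roots once. -/
theorem existsUnique_isSplitting {H : MultiHypergraph V (Option E)} (hH : H.incGraph.IsTree)
    {r : ι → V} (hr : ∀ v, v ∈ H.ends none ↔ ∃ i, r i = v) (hinj : Function.Injective r) :
    ∃! c : V ⊕ E → ι, H.IsSplitting r c := by
  choose c hc using reachable_removeNone hH.connected hr
  refine ⟨c, ⟨hr, fun i => ?_, fun v e h => ?_⟩, fun c' hc' => funext fun x => ?_⟩
  · exact eq_of_reachable_removeNone hH.isAcyclic hr hinj (hc _)
  · refine eq_of_reachable_removeNone hH.isAcyclic hr hinj ((hc _).trans (.trans ?_ (hc _).symm))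
    exact SimpleGraph.Adj.reachable (G := H.removeNone.incGraph) h
  · rw [← hc'.eq_of_reachable (hc x), hc'.root]

section glue

variable [Fintype ι] [DecidableEq V] (hι : 2 ≤ Fintype.card ι)

/-- Join one hypergraph for each `i` by an edge through the chosen vertices. -/
def glue (c : V ⊕ E → ι)
    (r : ∀ i, {v // c (.inl v) = i})
    (q : ∀ i, MultiHypergraph {v // c (.inl v) = i} {e // c (.inr e) = i}) :
    MultiHypergraph V (Option E) where
  ends
    | none => Finset.univ.image fun i => (r i : V)
    | some e => ((q (c (.inr e))).ends ⟨e, rfl⟩).map (Function.Embedding.subtype _)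
  two_le_card
    | none => by
      rwa [Finset.card_image_of_injective _ fun i k hik => ?_, Finset.card_univ]
      rw [← (r i).2, hik, (r k).2]
    | some e => by rw [Finset.card_map]; exact (q _).two_le_card _

theorem glue_isSplitting {c : V ⊕ E → ι} (r : ∀ i, {v // c (.inl v) = i})
    (q : ∀ i, MultiHypergraph {v // c (.inl v) = i} {e // c (.inr e) = i}) :
    (glue hι c r q).IsSplitting (fun i => (r i : V)) c where
  mem_ends_none v := by simp [glue]
  root i := (r i).2
  adj v e h := by
    simp only [glue, Finset.mem_map, Function.Embedding.subtype_apply] at h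
    obtain ⟨w, -, rfl⟩ := h
    exact w.2

end glue

section part

variable [DecidableEq ι]

/-- The part with index `i` of a hypergraph whose edges other than `none` respect the
colouring `c`. -/
def part (H : MultiHypergraph V (Option E)) {c : V ⊕ E → ι}
    (hc : ∀ v e, v ∈ H.ends (some e) → c (.inl v) = c (.inr e)) (i : ι) :
    MultiHypergraph {v // c (.inl v) = i} {e // c (.inr e) = i} where
  ends e := (H.ends (some e)).subtype _
  two_le_card e := by
    rw [Finset.card_subtype, Finset.filter_true_of_mem fun v hv => (hc v e hv).trans e.2]
    exact H.two_le_card _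

variable {H : MultiHypergraph V (Option E)} {r : ι → V} {c : V ⊕ E → ι}

theorem card_ends_part (hc : ∀ v e, v ∈ H.ends (some e) → c (.inl v) = c (.inr e)) (i : ι)
    (e : {e // c (.inr e) = i}) : ((H.part hc i).ends e).card = (H.ends (some e)).card := by
  rw [part, Finset.card_subtype, Finset.filter_true_of_mem fun v hv => (hc v e hv).trans e.2]

/-- The inclusion of a part into the whole. -/
def partHom (hc : ∀ v e, v ∈ H.ends (some e) → c (.inl v) = c (.inr e)) (i : ι) :
    (H.part hc i).incGraph →g H.incGraph where
  toFun := Sum.map (↑) fun e => some e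
  map_rel' := by
    rintro (v | e) (w | g) h
    · exact h.elim
    · exact Finset.mem_subtype.1 h
    · exact Finset.mem_subtype.1 h
    · exact h.elim

theorem IsSplitting.isTree_part (hH : H.incGraph.IsTree) (hc : H.IsSplitting r c) (i : ι) :
    (H.part hc.adj i).incGraph.IsTree := by
  refine ⟨SimpleGraph.connected_iff_exists_forall_reachable _ |>.2
    ⟨.inl ⟨r i, hc.root i⟩, fun x => ?_⟩, hH.isAcyclic.comap (partHom hc.adj i) ?_⟩
  -- Colours are constant along walks, so a walk from `r i` stays in part `i` and lifts to it.
  · have key (y : V ⊕ E) (hy : H.removeNone.incGraph.Reachable (.inl (r i)) y) :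
        ∃ x, Sum.map (↑) (↑) x = y ∧
          (H.part hc.adj i).incGraph.Reachable (.inl ⟨r i, hc.root i⟩) x := by
      have hyi := hc.eq_of_reachable hy
      rw [hc.root] at hyi
      rw [SimpleGraph.reachable_iff_reflTransGen] at hy
      induction hy with
      | refl => exact ⟨_, rfl, .refl _⟩
      | @tail y z hy hyz ih =>
        have hy' := hc.eq_of_reachable ((SimpleGraph.reachable_iff_reflTransGen _ _).2 hy)
        rw [hc.root] at hy'
        obtain ⟨x, rfl, hx⟩ := ih hy'
        rcases x with v | e <;> rcases z with w | g
        · exact hyz.elim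
        · refine ⟨.inr ⟨g, hyi.symm⟩, rfl, hx.trans (SimpleGraph.Adj.reachable ?_)⟩
          exact Finset.mem_subtype.2 hyz
        · refine ⟨.inl ⟨w, hyi.symm⟩, rfl, hx.trans (SimpleGraph.Adj.reachable ?_)⟩
          exact Finset.mem_subtype.2 hyz
        · exact hyz.elim
    obtain ⟨k, hk⟩ := reachable_removeNone hH.connected hc.mem_ends_none
      (Sum.map Subtype.val Subtype.val x)
    have hki := hc.eq_of_reachable hk
    rw [hc.root] at hki
    obtain rfl : k = i := by rw [hki]; rcases x with x | x <;> exact x.2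
    obtain ⟨x', hx', h⟩ := key _ hk
    rwa [(Subtype.val_injective.sumMap Subtype.val_injective) hx'] at h
  · exact Subtype.val_injective.sumMap
      ((Option.some_injective _).comp Subtype.val_injective)

/-- Connectedness passes through the edge `none`. Acyclicity comes from counting: the identities of
the parts are summed, and `none` adds `Fintype.card ι` incidences and one node. -/
theorem IsSplitting.isTree [Fintype ι] [Fintype V] [Fintype E] (hc : H.IsSplitting r c)
    (h : ∀ i, (H.part hc.adj i).incGraph.IsTree) : H.incGraph.IsTree := by
  classical
  rw [incGraph_isTree_iff_card]
  constructor
  · refine SimpleGraph.connected_iff_exists_forall_reachable _ |>.2 ⟨.inr none, ?_⟩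
    have hroot (i : ι) : H.incGraph.Reachable (.inr none) (.inl (r i)) :=
      SimpleGraph.Adj.reachable (G := H.incGraph) ((hc.mem_ends_none _).2 ⟨i, rfl⟩)
    rintro (v | _ | e)
    · exact (hroot (c (.inl v))).trans (((h _).connected.preconnected
        (.inl ⟨r _, hc.root _⟩) (.inl ⟨v, rfl⟩)).map (partHom hc.adj _))
    · exact .refl _
    · exact (hroot (c (.inr e))).trans (((h _).connected.preconnected
        (.inl ⟨r _, hc.root _⟩) (.inr ⟨e, rfl⟩)).map (partHom hc.adj _))
  · have hcard (i : ι) := (incGraph_isTree_iff_card.1 (h i)).2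
    simp only [card_ends_part] at hcard
    have hsum := Finset.sum_congr (rfl : (Finset.univ : Finset ι) = _) fun i _ => hcard i
    have h0 : (H.ends none).card = Fintype.card ι := by
      have : H.ends none = Finset.univ.image r := by
        ext v; simp [hc.mem_ends_none]
      rw [this, Finset.card_image_of_injective _ fun i k hik => ?_, Finset.card_univ]
      rw [← hc.root i, hik, hc.root]
    have hV := Fintype.sum_fiberwise (fun v : V => c (.inl v)) fun _ => 1
    have hE := Fintype.sum_fiberwise (fun e : E => c (.inr e)) fun _ => 1
    have hE' := Fintype.sum_fiberwise (fun e : E => c (.inr e)) fun e => (H.ends (some e)).card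
    simp only [Finset.sum_const, Finset.card_univ, smul_eq_mul, mul_one] at hV hE
    rw [Finset.sum_add_distrib, Finset.sum_add_distrib, hV, hE, hE'] at hsum
    rw [Fintype.sum_option, h0, Fintype.card_option]
    simp only [Finset.sum_const, Finset.card_univ, smul_eq_mul, mul_one] at hsum
    omega

variable [Fintype ι] [DecidableEq V] (hι : 2 ≤ Fintype.card ι)

theorem part_glue (r : ∀ i, {v // c (.inl v) = i})
    (q : ∀ i, MultiHypergraph {v // c (.inl v) = i} {e // c (.inr e) = i}) (i : ι) :
    (glue hι c r q).part (glue_isSplitting hι r q).adj i = q i := by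
  ext ⟨e, rfl⟩ ⟨v, hv⟩
  simp [part, glue, hv]

theorem glue_part (hc : H.IsSplitting r c) :
    glue hι c (fun i => ⟨r i, hc.root i⟩) (H.part hc.adj) = H := by
  ext (_ | e) v
  · simp [glue, hc.mem_ends_none]
  · simpa [glue, part] using hc.adj v e

end part

/-- The hypertrees whose edges have prescribed sizes. -/
abbrev SizedHypertree (V : Type*) {E : Type*} (s : E → ℕ) : Type _ :=
  {H : MultiHypergraph V E // (∀ e, (H.ends e).card = s e) ∧ H.incGraph.IsTree}

/-- Hypertrees split by `c` correspond to families of rooted hypertrees. -/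
def splittingEquiv [Fintype ι] [DecidableEq ι] [DecidableEq V] [Fintype V] [Fintype E]
    (hι : 2 ≤ Fintype.card ι) (s : E → ℕ) (c : V ⊕ E → ι) :
    {p : MultiHypergraph V (Option E) × (ι → V) //
      (∀ e, (p.1.ends (some e)).card = s e) ∧ p.1.incGraph.IsTree ∧ p.1.IsSplitting p.2 c} ≃
    ∀ i, {v // c (.inl v) = i} ×
      SizedHypertree {v // c (.inl v) = i} fun e : {e // c (.inr e) = i} => s e where
  toFun p i := (⟨p.1.2 i, p.2.2.2.root i⟩, ⟨p.1.1.part p.2.2.2.adj i,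
    fun e => (card_ends_part _ i e).trans (p.2.1 e), p.2.2.2.isTree_part p.2.2.1 i⟩)
  invFun q := ⟨(glue hι c (fun i => (q i).1) fun i => (q i).2.1, fun i => (q i).1),
    fun e => by simpa [glue] using (q (c (.inr e))).2.2.1 ⟨e, rfl⟩,
    (glue_isSplitting hι (fun i => (q i).1) fun i => (q i).2.1).isTree fun i => by
      rw [part_glue]; exact (q i).2.2.2,
    glue_isSplitting hι (fun i => (q i).1) fun i => (q i).2.1⟩
  left_inv p := Subtype.ext (Prod.ext (glue_part hι p.2.2.2) rfl)
  right_inv q := funext fun i => Prod.ext rfl (Subtype.ext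
    (part_glue hι (fun i => (q i).1) (fun i => (q i).2.1) i))

instance [Finite V] [Finite E] (s : E → ℕ) : Finite (SizedHypertree V s) :=
  inferInstanceAs (Finite {_H : MultiHypergraph V E // _})

/-- Summing over all ways to distribute vertices and edges, families of rooted hypertrees count
the hypertrees with one more edge, whose vertices are numbered. -/
theorem sum_prod_card_rooted [Fintype ι] [DecidableEq ι] [Fintype V] [Fintype E] [DecidableEq V]
    [DecidableEq E] (hι : 2 ≤ Fintype.card ι) (s : E → ℕ) :
    ∑ c : V ⊕ E → ι, ∏ i, Nat.card {v // c (.inl v) = i} *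
      Nat.card (SizedHypertree {v // c (.inl v) = i} fun e : {e // c (.inr e) = i} => s e) =
    (Fintype.card ι)! *
      Nat.card (SizedHypertree V fun e : Option E => e.elim (Fintype.card ι) s) := by
  classical
  have hfib (c : V ⊕ E → ι) := Nat.card_congr (splittingEquiv hι s c)
  simp only [Nat.card_pi, Nat.card_prod] at hfib
  simp_rw [← hfib]
  rw [← Nat.card_sigma]
  -- The colouring can be forgotten, being determined by the hypertree and its roots.
  let f : (Σ c : V ⊕ E → ι, {p : MultiHypergraph V (Option E) × (ι → V) //
      (∀ e, (p.1.ends (some e)).card = s e) ∧ p.1.incGraph.IsTree ∧ p.1.IsSplitting p.2 c}) →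
      {p : MultiHypergraph V (Option E) × (ι → V) //
        (∀ e, (p.1.ends (some e)).card = s e) ∧ p.1.incGraph.IsTree ∧
        Function.Injective p.2 ∧ ∀ v, v ∈ p.1.ends none ↔ ∃ i, p.2 i = v} := fun x =>
    ⟨x.2.1, x.2.2.1, x.2.2.2.1,
      fun i k hik => by rw [← x.2.2.2.2.root i, hik, x.2.2.2.2.root], x.2.2.2.2.mem_ends_none⟩
  have hf : Function.Bijective f := by
    constructor
    · rintro ⟨c, p, hp⟩ ⟨c', p', hp'⟩ h
      obtain rfl : p = p' := congrArg Subtype.val h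
      obtain rfl : c = c' := (existsUnique_isSplitting hp.2.1 hp.2.2.mem_ends_none
        (f ⟨c, p, hp⟩).2.2.2.1).unique hp.2.2 hp'.2.2
      rfl
    · rintro ⟨p, hp⟩
      obtain ⟨c, hc, -⟩ := existsUnique_isSplitting hp.2.1 hp.2.2.2 hp.2.2.1
      exact ⟨⟨c, p, hp.1, hp.2.1, hc⟩, rfl⟩
  rw [Nat.card_eq_of_bijective f hf]
  -- The roots amount to a numbering of the vertices of `none` by `ι`, which accounts for the
  -- factorial.
  let g : (Σ H : SizedHypertree V fun e : Option E => e.elim (Fintype.card ι) s,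
      ι ≃ H.1.ends none) →
      {p : MultiHypergraph V (Option E) × (ι → V) //
        (∀ e, (p.1.ends (some e)).card = s e) ∧ p.1.incGraph.IsTree ∧
        Function.Injective p.2 ∧ ∀ v, v ∈ p.1.ends none ↔ ∃ i, p.2 i = v} := fun x =>
    ⟨(x.1.1, fun i => x.2 i), fun e => x.1.2.1 (some e), x.1.2.2,
      Subtype.val_injective.comp x.2.injective, fun v =>
        ⟨fun hv => ⟨x.2.symm ⟨v, hv⟩, by simp⟩, by rintro ⟨i, rfl⟩; exact (x.2 i).2⟩⟩
  have hg : Function.Bijective g := by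
    constructor
    · rintro ⟨⟨H, hH⟩, σ⟩ ⟨⟨H', hH'⟩, σ'⟩ h
      obtain rfl : H = H' := congrArg (fun p => p.1.1) h
      obtain rfl : σ = σ' := Equiv.ext fun i => Subtype.ext (congrFun (congrArg (fun p => p.1.2) h) i)
      rfl
    · rintro ⟨⟨H, r⟩, h1, h2, h3, h4⟩
      let σ : ι → H.ends none := fun i => ⟨r i, (h4 _).2 ⟨i, rfl⟩⟩
      have hσ : Function.Bijective σ := ⟨fun i k hik => h3 (congrArg Subtype.val hik),
        fun ⟨v, hv⟩ => by obtain ⟨i, rfl⟩ := (h4 v).1 hv; exact ⟨i, rfl⟩⟩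
      refine ⟨⟨⟨H, ?_, h2⟩, Equiv.ofBijective σ hσ⟩, rfl⟩
      rintro (_ | e)
      · simpa using (Fintype.card_of_bijective hσ).symm
      · exact h1 e
  rw [← Nat.card_eq_of_bijective g hg]
  have : Fintype (SizedHypertree V fun e : Option E => e.elim (Fintype.card ι) s) :=
    Fintype.ofFinite _
  rw [Nat.card_sigma, Finset.sum_congr rfl (g := fun _ => (Fintype.card ι)!)]
  · rw [Finset.sum_const, Finset.card_univ, Nat.card_eq_fintype_card, smul_eq_mul, mul_comm]
  · intro H _
    rw [Nat.card_eq_fintype_card, Fintype.card_equiv (Fintype.equivOfCardEq ?_)]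
    simpa using (H.2.1 none).symm

end MultiHypergraph

/-! ### Invariance under relabelling -/

namespace MultiHypergraph

theorem card_sizedHypertree_le {V V' E E' : Type*} [Finite V'] [Finite E'] {s : E → ℕ}
    {s' : E' → ℕ} (f : V ≃ V') (g : E ≃ E') (h : ∀ e, s' (g e) = s e) :
    Nat.card (SizedHypertree V s) ≤ Nat.card (SizedHypertree V' s') := by
  let F (H : MultiHypergraph V E) : MultiHypergraph V' E' :=
    { ends := fun e => (H.ends (g.symm e)).map f.toEmbedding
      two_le_card := fun e => by rw [Finset.card_map]; exact H.two_le_card _ }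
  have hF (H : MultiHypergraph V E) : H.incGraph ≃g (F H).incGraph :=
    { toEquiv := Equiv.sumCongr f g
      map_rel_iff' := by
        rintro (v | e) (w | k)
        · exact Iff.rfl
        · change f v ∈ (H.ends (g.symm (g k))).map f.toEmbedding ↔ v ∈ H.ends k
          simp
        · change f w ∈ (H.ends (g.symm (g e))).map f.toEmbedding ↔ w ∈ H.ends e
          simp
        · exact Iff.rfl }
  refine Nat.card_le_card_of_injective (fun H : SizedHypertree V s => (⟨F H.1, fun e => ?_,
    (hF H.1).isTree_iff.1 H.2.2⟩ : SizedHypertree V' s')) fun H K hHK => ?_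
  · obtain ⟨e, rfl⟩ := g.surjective e
    simpa [F, h] using H.2.1 e
  · refine Subtype.ext (MultiHypergraph.ext (funext fun e => ?_))
    have := congrFun (congrArg (fun H => H.1.ends) hHK) (g e)
    simpa [F] using this

theorem card_sizedHypertree_congr {V V' E E' : Type*} [Finite V] [Finite E] {s : E → ℕ}
    {s' : E' → ℕ} (f : V ≃ V') (g : E ≃ E') (h : ∀ e, s' (g e) = s e) :
    Nat.card (SizedHypertree V s) = Nat.card (SizedHypertree V' s') := by
  have := Finite.of_equiv V f
  have := Finite.of_equiv E g
  exact (card_sizedHypertree_le f g h).antisymm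
    (card_sizedHypertree_le f.symm g.symm fun e => by rw [← h, g.apply_symm_apply])

end MultiHypergraph

/-! ### The hypertree series and its two identities -/

namespace HypergraphSeries

open MultiHypergraph MvPowerSeries

/-- The exponent of the monomial to which hypergraphs with vertex set `V` and edges `e` of size
`k e` contribute. -/
noncomputable def labelExponent (V : Type*) {E : Type*} [Fintype V] [Fintype E]
    (k : E → EdgeSize) : Option EdgeSize →₀ ℕ :=
  ∑ l : V ⊕ E, Finsupp.single (Sum.elim (fun _ => none) (fun e => some (k e)) l) 1

section labelExponent

variable {V E : Type*} [Fintype V] [Fintype E] (k : E → EdgeSize)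

theorem labelExponent_none : labelExponent V k none = Fintype.card V := by
  simp [labelExponent]

theorem labelExponent_some (j : EdgeSize) :
    labelExponent V k (some j) = Fintype.card {e // k e = j} := by
  classical
  simp [labelExponent, Finsupp.single_apply, Fintype.card_subtype]

theorem labelExponent_option (j : EdgeSize) :
    labelExponent V (fun e : Option E => e.elim j k) =
      labelExponent V k + Finsupp.single (some j) 1 := by
  simp only [labelExponent, Fintype.sum_sum_type, Fintype.sum_option, Sum.elim_inl, Sum.elim_inr,
    Option.elim_none, Option.elim_some]
  abel

theorem labelExponent_fiber {ι : Type*} [DecidableEq ι] (c : V ⊕ E → ι) (i : ι) :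
    (∑ l : V ⊕ E, if c l = i then
      Finsupp.single (Sum.elim (fun _ => none) (fun e => some (k e)) l) 1 else 0) =
    labelExponent {v // c (.inl v) = i} fun e : {e // c (.inr e) = i} => k e := by
  rw [labelExponent, Fintype.sum_sum_type, Fintype.sum_sum_type, ← Finset.sum_filter,
    ← Finset.sum_filter]
  congr 1
  · exact (Finset.sum_subtype _ (by simp) _)
  · exact (Finset.sum_subtype _ (by simp) _)

end labelExponent

noncomputable instance (lam : EdgeSize →₀ ℕ) : Fintype (EdgeLabel lam) := Fintype.ofFinite _

theorem card_edgeLabel_fiber (lam : EdgeSize →₀ ℕ) (j : EdgeSize) :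
    Fintype.card {e : EdgeLabel lam // e.1 = j} = lam j := by
  rw [Fintype.card_congr (Equiv.sigmaSubtype j), Fintype.card_fin]

theorem labelExponent_edgeLabel (d : Option EdgeSize →₀ ℕ) :
    labelExponent (Fin (d none)) (fun e : EdgeLabel d.some => e.1) = d := by
  ext (_ | j)
  · rw [labelExponent_none, Fintype.card_fin]
  · rw [labelExponent_some, card_edgeLabel_fiber, Finsupp.some_apply]

theorem prod_factorial_option (d : Option EdgeSize →₀ ℕ) :
    (d.prod fun _ k => (k ! : ℚ)) = (d none)! * d.some.prod fun _ k => (k ! : ℚ) := by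
  rw [Finsupp.prod_of_support_subset d (s := Finset.insertNone d.some.support) _ _ (by simp),
    Finset.prod_insertNone]
  · rfl
  · rintro (_ | j) h
    · simp
    · simpa using h

theorem egfCoeff_hypertreeEGF (d : Option EdgeSize →₀ ℕ) :
    egfCoeff d hypertreeEGF =
      Nat.card (SizedHypertree (Fin (d none)) fun e : EdgeLabel d.some => e.1) := by
  rw [egfCoeff, prod_factorial_option]
  change _ * (if d none = 0 then 0 else _) = _
  split_ifs with h
  -- The value 0 by convention is also the true count, as an incidence tree needs a vertex.
  · rw [mul_zero, eq_comm, Nat.cast_eq_zero, h, Nat.card_eq_zero]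
    refine .inl ⟨fun H => ?_⟩
    exact (incGraph_isTree_iff.1 H.2.2).1.elim Fin.elim0
  · rw [mul_div_cancel₀ _ (by rw [← prod_factorial_option]; exact prod_factorial_ne_zero d),
      hypertreeCount, Nat.cast_inj]
    have : Nonempty (Fin (d none)) := ⟨⟨0, Nat.pos_of_ne_zero h⟩⟩
    simp only [SizedHypertree, incGraph_isTree_iff, this, true_and]

/-- Relabelling invariance frees the coefficients from standard labels; the parts of a splitting
carry arbitrary subtypes as labels. -/
theorem egfCoeff_labelExponent {V E : Type*} [Fintype V] [Fintype E] (k : E → EdgeSize) :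
    egfCoeff (labelExponent V k) hypertreeEGF =
      Nat.card (SizedHypertree V fun e => (k e : ℕ)) := by
  rw [egfCoeff_hypertreeEGF, Nat.cast_inj, eq_comm]
  refine card_sizedHypertree_congr (Fintype.equivFinOfCardEq (labelExponent_none k).symm)
    ((Equiv.sigmaFiberEquiv k).symm.trans (Equiv.sigmaCongrRight fun j =>
      Fintype.equivFinOfCardEq (labelExponent_some (V := V) k j).symm)) fun e => rfl

theorem coeff_X_mul_pderiv {σ : Type*} (i : σ) (d : σ →₀ ℕ) (F : MvPowerSeries σ ℚ) :
    coeff d (X i * pderiv ℚ i F) = d i * coeff d F := by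
  classical
  rw [X, coeff_monomial_mul, one_mul]
  split_ifs with h
  · obtain ⟨e, rfl⟩ := exists_add_of_le h
    rw [add_tsub_cancel_left, coeff_pderiv, add_comm e]
    simp [mul_comm, add_comm]
  · have : d i = 0 := by
      by_contra hd
      exact h (Finsupp.single_le_iff.2 (Nat.one_le_iff_ne_zero.2 hd))
    simp [this]

/-- Removing an edge of size `j` from a hypertree leaves `j` rooted hypertrees. -/
theorem rooted_pow (j : EdgeSize) :
    (t * dt hypertreeEGF) ^ (j : ℕ) = ((j : ℕ)! : ℚ) • pderiv ℚ (some j) hypertreeEGF := by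
  ext d
  suffices h : egfCoeff d ((t * dt hypertreeEGF) ^ (j : ℕ)) =
      (j : ℕ)! * egfCoeff (d + Finsupp.single (some j) 1) hypertreeEGF by
    rw [egfCoeff_add_single, egfCoeff, egfCoeff, mul_left_comm] at h
    exact mul_left_cancel₀ (prod_factorial_ne_zero d) h
  classical
  have hR (e : Option EdgeSize →₀ ℕ) :
      egfCoeff e (t * dt hypertreeEGF) = e none * egfCoeff e hypertreeEGF := by
    rw [egfCoeff, t, dt, coeff_X_mul_pderiv, egfCoeff]
    ring
  have hpow : (t * dt hypertreeEGF) ^ (j : ℕ) = ∏ _i : Fin j, t * dt hypertreeEGF := by simp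
  have hj : 2 ≤ Fintype.card (Fin (j : ℕ)) := by simpa using j.2
  have hsum := sum_prod_card_rooted (V := Fin (d none)) hj fun e : EdgeLabel d.some => (e.1 : ℕ)
  -- The monomial `d` is realised by actual labels, so that the product formula becomes a sum over
  -- colourings.
  rw [← labelExponent_edgeLabel d, ← labelExponent_option, egfCoeff_labelExponent, hpow,
    labelExponent, egfCoeff_prod]
  simp_rw [labelExponent_fiber (fun e : EdgeLabel d.some => e.1), hR, egfCoeff_labelExponent,
    labelExponent_none]
  rw [Fintype.card_fin] at hsum
  have helim : (fun e : Option (EdgeLabel d.some) => ((e.elim j fun e => e.1 : EdgeSize) : ℕ)) =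
      fun e => e.elim (j : ℕ) fun e => (e.1 : ℕ) := by
    funext e; cases e <;> rfl
  rw [helim, ← Nat.cast_mul, ← hsum]
  push_cast
  simp only [Nat.card_eq_fintype_card]

/-- The relation between the numbers of vertices and edges of a hypertree. -/
theorem coeff_hypertreeEGF_eq (d : Option EdgeSize →₀ ℕ) :
    coeff d hypertreeEGF = d none * coeff d hypertreeEGF -
      ∑ j ∈ d.some.support, ((j : ℕ) - 1 : ℚ) * (d (some j) * coeff d hypertreeEGF) := by
  classical
  by_cases h : coeff d hypertreeEGF = 0
  · simp [h]
  have hcard : Nat.card (SizedHypertree (Fin (d none)) fun e : EdgeLabel d.some => e.1) ≠ 0 := by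
    rw [← Nat.cast_ne_zero (R := ℚ), ← egfCoeff_hypertreeEGF]
    exact mul_ne_zero (prod_factorial_ne_zero d) h
  -- A nonzero coefficient supplies one hypertree, whose node count fixes the relation for all with
  -- these sizes.
  obtain ⟨⟨H, hs, hH⟩⟩ := (Nat.card_ne_zero.1 hcard).1
  have hc := (incGraph_isTree_iff_card.1 hH).2
  simp only [hs, Fintype.card_fin] at hc
  have hsum : ∑ e : EdgeLabel d.some, (((e.1 : ℕ) : ℚ) - 1) =
      ∑ j ∈ d.some.support, ((j : ℕ) - 1 : ℚ) * d (some j) := by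
    rw [← Finset.sum_fiberwise_of_maps_to (g := fun e : EdgeLabel d.some => e.1)
      (t := d.some.support) fun e _ => Finsupp.mem_support_iff.2 fun h => (Fin.cast h e.2).elim0]
    refine Finset.sum_congr rfl fun j _ => ?_
    rw [Finset.sum_congr rfl (g := fun _ => ((j : ℕ) : ℚ) - 1), Finset.sum_const,
      ← Fintype.card_subtype, card_edgeLabel_fiber, nsmul_eq_mul, mul_comm, Finsupp.some_apply]
    intro e he
    rw [(Finset.mem_filter.1 he).2]
  rw [Finset.sum_sub_distrib, Finset.sum_const, Finset.card_univ, nsmul_eq_mul, mul_one] at hsum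
  simp_rw [← mul_assoc]
  rw [← Finset.sum_mul, ← hsum, ← sub_mul]
  have hc' : (∑ e : EdgeLabel d.some, ((e.1 : ℕ) : ℚ)) + 1 =
      d none + Fintype.card (EdgeLabel d.some) := by exact_mod_cast hc
  rw [show (d none : ℚ) - (∑ e : EdgeLabel d.some, ((e.1 : ℕ) : ℚ) -
    Fintype.card (EdgeLabel d.some)) = 1 by linarith, one_mul]

end HypergraphSeries

/-- The infinite sum is taken in the ring of formal power series with the topology of
coefficientwise convergence, the coefficient field being discrete. -/
theorem mainTheorem5 :
    letI : TopologicalSpace ℚ := ⊥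
    let T : HypergraphSeries := HypergraphSeries.hypertreeEGF
    let R : HypergraphSeries := HypergraphSeries.t * HypergraphSeries.dt T
    let term : EdgeSize → HypergraphSeries := fun j =>
      (((j : ℕ) : ℚ) - 1) • HypergraphSeries.u j * ((1 / ((j : ℕ)! : ℚ)) • R ^ (j : ℕ))
    Summable term ∧ T = R - ∑' j : EdgeSize, term j := by
  let _ : TopologicalSpace ℚ := ⊥
  intro T R term
  have : DiscreteTopology ℚ := ⟨rfl⟩
  have hterm (j : EdgeSize) (d : Option EdgeSize →₀ ℕ) : MvPowerSeries.coeff d (term j) =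
      ((j : ℕ) - 1 : ℚ) * (d (some j) * MvPowerSeries.coeff d T) := by
    have hj : ((j : ℕ)! : ℚ) ≠ 0 := by positivity
    simp only [term, R, T]
    rw [HypergraphSeries.rooted_pow, smul_smul, one_div_mul_cancel hj, one_smul, smul_mul_assoc,
      MvPowerSeries.coeff_smul, HypergraphSeries.u, HypergraphSeries.coeff_X_mul_pderiv]
  have hsum : HasSum term (R - T) := by
    rw [MvPowerSeries.WithPiTopology.hasSum_iff_hasSum_coeff]
    intro d
    have hR : MvPowerSeries.coeff d R = d none * MvPowerSeries.coeff d T :=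
      HypergraphSeries.coeff_X_mul_pderiv none d T
    have hd : MvPowerSeries.coeff d (R - T) =
        ∑ j ∈ d.some.support, MvPowerSeries.coeff d (term j) := by
      simp_rw [hterm]
      rw [map_sub, hR]
      linarith [HypergraphSeries.coeff_hypertreeEGF_eq d]
    rw [hd]
    -- Terms with `u j` absent from the monomial vanish there, so coefficientwise the sum is finite.
    refine hasSum_sum_of_ne_finset_zero fun j hj => ?_
    have : d (some j) = 0 := by simpa using hj
    rw [hterm, this]
    simp
  refine ⟨hsum.summable, ?_⟩
  rw [hsum.tsum_eq, sub_sub_cancel]
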